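/- A Banach lattice is a real vector lattice $X$ which is also a Banach space under a norm such that $|x|\le|y|$ implies $\|x\|\le\|y\|$. A Banach sequence lattice is a linear space $Y$ of real sequences, with a complete norm $\|\cdot\|_Y$, such that every canonical sequence $e_k$ belongs to $Y$ and such that, if $g\in Y$ and $f$ is a real sequence with $|f|\le|g|$ coordinatewise, then $f\in Y$ and $\|f\|_Y\le\|g\|_Y$. For $t=(t_1,\dots,t_n)\in\mathbb R^n$ put $$\|t\|_{\mathbb R^n,Y}:=\|(t_1,\dots,t_n,0,0,\dots)\|_Y,$$ and for $a=(a_1,\dots,a_n)\in\mathbb R^n$ put $$\|a\|_{Y^*}:=\sup\Big\{\Big|\sum_{j=1}^n a_jt_j\Big| : t\in\mathbb R^n,\ \|t\|_{\mathbb R^n,Y}\le 1\Big\}.$$ Let $\mathcal H_n$ be the vector lattice, with pointwise operations, of all continuous functions $h:\mathbb R^n\to\mathbb R$ with $h(\lambda t)=\lambda h(t)$ for all $\lambda\ge 0$ and $t\in\mathbb R^n$; it contains $\|\cdot\|_{\mathbb R^n,Y}$ and the coordinate projections $\pi_{n,j}(t)=t_j$. **Proposition.** Let $X$ be a Banach lattice,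 $Y$ a Banach sequence lattice, $n\in\mathbb N$ and $x=(x_1,\dots,x_n)\in X^n$. There is exactly one linear map $\tau_{n,x}:\mathcal H_n\to X$ with $\tau_{n,x}(\pi_{n,j})=x_j$ for $1\le j\le n$ and $\tau_{n,x}(h_1\vee h_2)=\tau_{n,x}(h_1)\vee\tau_{n,x}(h_2)$ for all $h_1,h_2\in\mathcal H_n$ (Krivine's functional calculus). Put $$\|(x_1,\dots,x_n)\|_Y:=\tau_{n,x}\big(\|\cdot\|_{\mathbb R^n,Y}\big)\in X.$$ Then the set $\big\{\sum_{j=1}^n a_jx_j : a\in\mathbb R^n,\ \|a\|_{Y^*}\le 1\big\}$ has a least upper bound in $X$, and $$\|(x_1,\dots,x_n)\|_Y=\sup\Big\{\sum_{j=1}^n a_jx_j : a\in\mathbb R^n,\ \|(a_1,\dots,a_n)\|_{Y^*}\le 1\Big\}.$$ -/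

import Mathlib

/-- A Banach sequence lattice: an ideal `carrier` of real sequences, with a complete
order-preserving norm, which contains every canonical sequence `e_k`. -/
structure BanachSequenceLattice where
  carrier : Submodule ℝ (ℕ → ℝ)
  norm : Seminorm ℝ carrier
  eq_zero_of_norm_eq_zero : ∀ f : carrier, norm f = 0 → f = 0
  solid : ∀ (f : ℕ → ℝ) (g : carrier), (∀ k, |f k| ≤ |(g : ℕ → ℝ) k|) →
    ∃ hf : f ∈ carrier, norm ⟨f, hf⟩ ≤ norm g
  complete : ∀ u : ℕ → carrier,
    (∀ ε > 0, ∃ N, ∀ m ≥ N, ∀ k ≥ N, norm (u m - u k) < ε) →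
      ∃ f : carrier, ∀ ε > 0, ∃ N, ∀ m ≥ N, norm (u m - f) < ε
  single_mem : ∀ k : ℕ, (Pi.single k 1 : ℕ → ℝ) ∈ carrier

/-- The space `ℋ_n` of continuous functions `h : ℝⁿ → ℝ` such that `h (c t) = c h t`
for all `c ≥ 0`. -/
def HomogFun (n : ℕ) : Submodule ℝ C(Fin n → ℝ, ℝ) where
  carrier := {h | ∀ c : ℝ, 0 ≤ c → ∀ t : Fin n → ℝ, h (c • t) = c * h t}
  add_mem' := by
    intro f g hf hg c hc t
    simp only [ContinuousMap.add_apply, hf c hc t, hg c hc t]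
    ring
  zero_mem' := by
    intro c _ t
    simp
  smul_mem' := by
    intro r f hf c hc t
    simp only [ContinuousMap.smul_apply, smul_eq_mul, hf c hc t]
    ring

namespace HomogFun

theorem sup_mem {n : ℕ} {f g : C(Fin n → ℝ, ℝ)} (hf : f ∈ HomogFun n) (hg : g ∈ HomogFun n) :
    f ⊔ g ∈ HomogFun n := by
  intro c hc t
  simp only [ContinuousMap.sup_apply, hf c hc t, hg c hc t]
  exact (mul_max_of_nonneg _ _ hc).symm

/-- The pointwise supremum on `ℋ_n`. -/
instance instMax (n : ℕ) : Max (HomogFun n) :=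
  ⟨fun f g => ⟨(f : C(Fin n → ℝ, ℝ)) ⊔ (g : C(Fin n → ℝ, ℝ)), sup_mem f.2 g.2⟩⟩

/-- The coordinate projection `π_j`. -/
def proj (n : ℕ) (j : Fin n) : HomogFun n :=
  ⟨⟨fun t => t j, continuous_apply j⟩, fun _ _ _ => rfl⟩

end HomogFun

namespace BanachSequenceLattice

/-- The sequence `(t_1, …, t_n, 0, 0, …)`. -/
def extendByZero (n : ℕ) : (Fin n → ℝ) →ₗ[ℝ] (ℕ → ℝ) where
  toFun t k := if hk : k < n then t ⟨k, hk⟩ else 0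
  map_add' s t := by
    ext k
    by_cases hk : k < n <;> simp [hk]
  map_smul' c t := by
    ext k
    by_cases hk : k < n <;> simp [hk]

theorem extendByZero_mem (Y : BanachSequenceLattice) (n : ℕ) (t : Fin n → ℝ) :
    extendByZero n t ∈ Y.carrier := by
  have h : extendByZero n t = ∑ j : Fin n, t j • (Pi.single (j : ℕ) 1 : ℕ → ℝ) := by
    ext k
    simp only [extendByZero, LinearMap.coe_mk, AddHom.coe_mk, Finset.sum_apply, Pi.smul_apply,
      smul_eq_mul, Pi.single_apply, mul_ite, mul_one, mul_zero]
    by_cases hk : k < n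
    · rw [dif_pos hk, Finset.sum_eq_single (⟨k, hk⟩ : Fin n)]
      · simp
      · intro b _ hb
        rw [if_neg]
        intro hkb
        exact hb (Fin.ext hkb.symm)
      · simp
    · rw [dif_neg hk]
      refine (Finset.sum_eq_zero fun j _ => ?_).symm
      rw [if_neg]
      intro hkj
      exact hk (hkj ▸ j.2)
  rw [h]
  exact Submodule.sum_mem _ fun j _ => Submodule.smul_mem _ _ (Y.single_mem j)

/-- The norm `‖·‖_{ℝⁿ,Y}` induced on `ℝⁿ` by the norm of `Y`. -/
def normRn (Y : BanachSequenceLattice) (n : ℕ) : Seminorm ℝ (Fin n → ℝ) :=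
  Y.norm.comp ((extendByZero n).codRestrict Y.carrier (Y.extendByZero_mem n))

theorem continuous_normRn (Y : BanachSequenceLattice) (n : ℕ) :
    Continuous fun t : Fin n → ℝ => Y.normRn n t :=
  continuousOn_univ.mp ((Y.normRn n).convexOn.continuousOn isOpen_univ)

/-- The norm `‖·‖_{ℝⁿ,Y}` as an element of `ℋ_n`. -/
def normHomog (Y : BanachSequenceLattice) (n : ℕ) : HomogFun n :=
  ⟨⟨fun t => Y.normRn n t, Y.continuous_normRn n⟩, fun c hc t => by
    simp [map_smul_eq_mul, abs_of_nonneg hc]⟩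

/-- The dual norm `‖·‖_{Y*}` on `ℝⁿ`. The supremum is over a nonempty bounded set,
as `‖·‖_{ℝⁿ,Y}` is a norm on `ℝⁿ`. -/
noncomputable def dualNorm (Y : BanachSequenceLattice) (n : ℕ) (a : Fin n → ℝ) : ℝ :=
  sSup {r : ℝ | ∃ t : Fin n → ℝ, Y.normRn n t ≤ 1 ∧ r = |∑ j, a j * t j|}

end BanachSequenceLattice

section Krivine

variable {X : Type*} [NormedAddCommGroup X] [NormedSpace ℝ X] [Lattice X] {n : ℕ}

/-- The two properties that characterize Krivine's functional calculus `τ_{n,x}`. -/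
structure IsKrivineCalculus (x : Fin n → X) (τ : HomogFun n →ₗ[ℝ] X) : Prop where
  map_proj : ∀ j, τ (HomogFun.proj n j) = x j
  map_sup : ∀ f g : HomogFun n, τ (f ⊔ g) = τ f ⊔ τ g

open Classical in
/-- Krivine's functional calculus `τ_{n,x} : ℋ_n → X`: the linear map with the properties
`IsKrivineCalculus` (the value `0` is used only if there were no such map). -/
noncomputable def krivineCalculus (x : Fin n → X) : HomogFun n →ₗ[ℝ] X :=
  if h : ∃ τ : HomogFun n →ₗ[ℝ] X, IsKrivineCalculus x τ then h.choose else 0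

/-- The element `‖(x_1, …, x_n)‖_Y := τ_{n,x} (‖·‖_{ℝⁿ,Y})` of `X`. -/
noncomputable def krivineNorm (Y : BanachSequenceLattice) (x : Fin n → X) : X :=
  krivineCalculus x (Y.normHomog n)

end Krivine

/-!
Krivine's functional calculus is built without representing `X` as a function space. Its graph is
a vector sublattice of `(ℝⁿ → ℝ) × X`. It arises from the generators `(π_j, x_j)` by taking
differences `p - q` of those suprema of linear combinations which exist (`latticeSpan`), and then
uniform limits relative to `∑ j, |(π_j, x_j)|` (`uniformLatticeSpan`). Finite suprema would be
enough, but finiteness plays no role.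

The point is positivity: if two such suprema satisfy `p ≤ q` in the first component, then `p ≤ q`
in the second (`snd_le_snd_of_mem_linearSups`). Indeed, if `a · t ≤ ⋁_{b ∈ T} b · t` for all
`t ∈ ℝⁿ`, then by Hahn–Banach separation `a` lies in the closed convex hull of `T`, and
`∑ j, b_j x_j ≤ y`, for fixed `y ∈ X`, is a closed convex condition on `b ∈ ℝⁿ`. Positivity
passes to uniform limits, so that the graph is single-valued. It meets every function in `ℋ_n`,
since the functions in a vector sublattice which contains the `π_j` are dense by the
Stone–Weierstrass theorem on the `ℓ¹` sphere (`HomogFun.exists_approx`) and `X` is complete. As the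
graph is a vector sublattice of the product, the map is a linear lattice homomorphism. The same
density gives uniqueness.

For the supremum formula, `‖t‖_{ℝⁿ,Y}` is the maximum of `a · t` over `‖a‖_{Y*} ≤ 1`. The easy
inequality makes `τ ‖·‖` an upper bound. If `u` is another one, then the functions `h` with
`τ h ≤ u` are closed under suprema and contain the functionals `a`, so that compactness of the
sphere yields such an `h` with `‖·‖ ≤ h + ε ∑ j, |π_j|`; apply `τ` and let `ε → 0`.
-/

open Filter Topology
open scoped Pointwise

/-! ### Differences of suprema of linear combinations -/

section VectorLattice

variable {Z : Type*} [AddCommGroup Z] [Module ℝ Z] [Lattice Z] {n : ℕ}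

/-- The elements of a vector lattice `Z` which are the least upper bound of some set of linear
combinations of `z`. Neither finiteness nor nonemptiness of the set is required. -/
def linearSups (z : Fin n → Z) : Set Z :=
  {p | ∃ S : Set (Fin n → ℝ), IsLUB (Fintype.linearCombination ℝ z '' S) p}

theorem zero_mem_linearSups (z : Fin n → Z) : (0 : Z) ∈ linearSups z :=
  ⟨{0}, by simp⟩

theorem mem_linearSups_apply (z : Fin n → Z) (j : Fin n) : z j ∈ linearSups z :=
  ⟨{Pi.single j 1}, by simp⟩

theorem sup_mem_linearSups {z : Fin n → Z} {p q : Z} (hp : p ∈ linearSups z)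
    (hq : q ∈ linearSups z) : p ⊔ q ∈ linearSups z := by
  obtain ⟨S, hS⟩ := hp
  obtain ⟨T, hT⟩ := hq
  exact ⟨S ∪ T, by simpa only [Set.image_union] using hS.union hT⟩

theorem smul_mem_linearSups [PosSMulMono ℝ Z] {z : Fin n → Z} {p : Z} {c : ℝ} (hc : 0 ≤ c)
    (hp : p ∈ linearSups z) : c • p ∈ linearSups z := by
  rcases hc.eq_or_lt with rfl | hc
  · simpa only [zero_smul] using zero_mem_linearSups z
  · obtain ⟨S, hS⟩ := hp
    refine ⟨c • S, ?_⟩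
    have h := (OrderIso.smulRight (β := Z) hc).isLUB_image'.2 hS
    rw [Set.image_image] at h
    rw [← Set.image_smul, Set.image_image]
    simp only [map_smul]
    exact h

variable [IsOrderedAddMonoid Z]

theorem add_mem_linearSups {z : Fin n → Z} {p q : Z} (hp : p ∈ linearSups z)
    (hq : q ∈ linearSups z) : p + q ∈ linearSups z := by
  obtain ⟨S, hS⟩ := hp
  obtain ⟨T, hT⟩ := hq
  exact ⟨S + T, by simpa only [Set.image_add] using hS.add hT⟩

variable [PosSMulMono ℝ Z]

/-- The vector sublattice of the differences of elements of `linearSups z`. It contains the one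
generated by `z`, and may be larger, as the suprema need not be finite. -/
def latticeSpan (z : Fin n → Z) : Submodule ℝ Z where
  carrier := {v | ∃ p ∈ linearSups z, ∃ q ∈ linearSups z, v = p - q}
  add_mem' := by
    rintro _ _ ⟨p, hp, q, hq, rfl⟩ ⟨r, hr, s, hs, rfl⟩
    exact ⟨p + r, add_mem_linearSups hp hr, q + s, add_mem_linearSups hq hs, by abel⟩
  zero_mem' := ⟨0, zero_mem_linearSups z, 0, zero_mem_linearSups z, by simp⟩
  smul_mem' := by
    rintro c _ ⟨p, hp, q, hq, rfl⟩
    rcases le_total 0 c with hc | hc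
    · exact ⟨c • p, smul_mem_linearSups hc hp, c • q, smul_mem_linearSups hc hq, smul_sub ..⟩
    · have hc' : 0 ≤ -c := neg_nonneg.2 hc
      exact ⟨-c • q, smul_mem_linearSups hc' hq, -c • p, smul_mem_linearSups hc' hp, by module⟩

theorem mem_latticeSpan_apply (z : Fin n → Z) (j : Fin n) : z j ∈ latticeSpan z :=
  ⟨z j, mem_linearSups_apply z j, 0, zero_mem_linearSups z, (sub_zero _).symm⟩

theorem sup_mem_latticeSpan {z : Fin n → Z} {v w : Z} (hv : v ∈ latticeSpan z)
    (hw : w ∈ latticeSpan z) : v ⊔ w ∈ latticeSpan z := by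
  obtain ⟨p, hp, q, hq, rfl⟩ := hv
  obtain ⟨r, hr, s, hs, rfl⟩ := hw
  refine ⟨(p + s) ⊔ (r + q), sup_mem_linearSups (add_mem_linearSups hp hs)
    (add_mem_linearSups hr hq), q + s, add_mem_linearSups hq hs, ?_⟩
  rw [sup_sub]
  congr 1 <;> abel

/-- The element `∑ j, |z j|`, relative to which approximation is measured. -/
def absSum (z : Fin n → Z) : Z := ∑ j, |z j|

theorem absSum_mem_latticeSpan (z : Fin n → Z) : absSum z ∈ latticeSpan z :=
  Submodule.sum_mem _ fun j _ => sup_mem_latticeSpan (mem_latticeSpan_apply z j)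
    (Submodule.neg_mem _ (mem_latticeSpan_apply z j))

/-- The closure of `latticeSpan z` under uniform convergence relative to `absSum z`. The two
one-sided inequalities amount to `|w - v| ≤ ε • absSum z`. -/
def uniformLatticeSpan (z : Fin n → Z) : Submodule ℝ Z where
  carrier := {w | ∀ ε > (0 : ℝ), ∃ v ∈ latticeSpan z,
    w ≤ v + ε • absSum z ∧ v ≤ w + ε • absSum z}
  add_mem' := by
    intro w w' hw hw' ε hε
    obtain ⟨v, hv, h1, h2⟩ := hw (ε / 2) (half_pos hε)
    obtain ⟨v', hv', h1', h2'⟩ := hw' (ε / 2) (half_pos hε)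
    refine ⟨v + v', Submodule.add_mem _ hv hv', (add_le_add h1 h1').trans_eq ?_,
      (add_le_add h2 h2').trans_eq ?_⟩ <;> module
  zero_mem' := by
    intro ε hε
    have h : (0 : Z) ≤ ε • absSum z :=
      smul_nonneg hε.le (Finset.sum_nonneg fun j _ => abs_nonneg (z j))
    exact ⟨0, Submodule.zero_mem _, by simpa using h, by simpa using h⟩
  smul_mem' := by
    intro c w hw ε hε
    rcases lt_trichotomy c 0 with hc | rfl | hc
    · have hc' : 0 < -c := neg_pos.2 hc
      obtain ⟨v, hv, h1, h2⟩ := hw (ε / -c) (div_pos hε hc')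
      have e1 := smul_le_smul_of_nonneg_left h1 hc'.le
      have e2 := smul_le_smul_of_nonneg_left h2 hc'.le
      rw [smul_add, smul_smul, mul_div_cancel₀ _ hc'.ne', neg_smul, neg_smul] at e1 e2
      refine ⟨c • v, Submodule.smul_mem _ _ hv, ?_, ?_⟩
      · rw [neg_le_iff_add_nonneg] at e2
        rw [← sub_nonneg]
        exact e2.trans_eq (by abel)
      · rw [neg_le_iff_add_nonneg] at e1
        rw [← sub_nonneg]
        exact e1.trans_eq (by abel)
    · have h : (0 : Z) ≤ ε • absSum z :=
        smul_nonneg hε.le (Finset.sum_nonneg fun j _ => abs_nonneg (z j))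
      exact ⟨0, Submodule.zero_mem _, by simpa using h, by simpa using h⟩
    · obtain ⟨v, hv, h1, h2⟩ := hw (ε / c) (div_pos hε hc)
      have e1 := smul_le_smul_of_nonneg_left h1 hc.le
      have e2 := smul_le_smul_of_nonneg_left h2 hc.le
      rw [smul_add, smul_smul, mul_div_cancel₀ _ hc.ne'] at e1 e2
      exact ⟨c • v, Submodule.smul_mem _ _ hv, e1, e2⟩

theorem latticeSpan_le_uniformLatticeSpan (z : Fin n → Z) :
    latticeSpan z ≤ uniformLatticeSpan z := by
  intro v hv ε hε
  have h : (0 : Z) ≤ ε • absSum z :=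
    smul_nonneg hε.le (Finset.sum_nonneg fun j _ => abs_nonneg (z j))
  exact ⟨v, hv, le_add_of_nonneg_right h, le_add_of_nonneg_right h⟩

theorem sup_mem_uniformLatticeSpan {z : Fin n → Z} {w w' : Z} (hw : w ∈ uniformLatticeSpan z)
    (hw' : w' ∈ uniformLatticeSpan z) : w ⊔ w' ∈ uniformLatticeSpan z := by
  intro ε hε
  obtain ⟨v, hv, h1, h2⟩ := hw ε hε
  obtain ⟨v', hv', h1', h2'⟩ := hw' ε hε
  refine ⟨v ⊔ v', sup_mem_latticeSpan hv hv', ?_, ?_⟩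
  · rw [sup_add]
    exact sup_le_sup h1 h1'
  · rw [sup_add]
    exact sup_le_sup h2 h2'

end VectorLattice

/-! ### Homogeneous functions -/

namespace HomogFun

variable {n : ℕ}

theorem ext' {f g : HomogFun n} (h : ∀ t, f.1 t = g.1 t) : f = g :=
  Subtype.ext (ContinuousMap.ext h)

/-- A homogeneous function, regarded as an element of the vector lattice of all functions. -/
def toFun (n : ℕ) : HomogFun n →ₗ[ℝ] ((Fin n → ℝ) → ℝ) where
  toFun h := fun t => h.1 t
  map_add' _ _ := rfl
  map_smul' _ _ := rfl

/-- The function `t ↦ ∑ j, |t j|`. -/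
def l1 (n : ℕ) : HomogFun n := ∑ j, (proj n j ⊔ -proj n j)

theorem l1_apply (t : Fin n → ℝ) : (l1 n).1 t = ∑ j, |t j| := by
  change toFun n (l1 n) t = _
  rw [l1, map_sum, Finset.sum_apply]
  rfl

theorem l1_eq_zero {t : Fin n → ℝ} (h : (l1 n).1 t = 0) : t = 0 := by
  rw [l1_apply, Finset.sum_eq_zero_iff_of_nonneg fun j _ => abs_nonneg _] at h
  exact funext fun j => abs_eq_zero.1 (h j (Finset.mem_univ j))

theorem l1_nonneg (t : Fin n → ℝ) : 0 ≤ (l1 n).1 t := by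
  rw [l1_apply]
  exact Finset.sum_nonneg fun j _ => abs_nonneg _

/-- The unit sphere of the `ℓ¹` norm; it is empty for `n = 0`. -/
def sphere (n : ℕ) : Set (Fin n → ℝ) := {t | (l1 n).1 t = 1}

theorem isCompact_sphere (n : ℕ) : IsCompact (sphere n) := by
  refine Metric.isCompact_of_isClosed_isBounded
    (isClosed_singleton.preimage (l1 n).1.continuous) ?_
  refine (Metric.isBounded_closedBall (x := (0 : Fin n → ℝ)) (r := 1)).subset fun t ht => ?_
  rw [mem_closedBall_zero_iff, pi_norm_le_iff_of_nonneg zero_le_one]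
  intro j
  have ht' : ∑ j, |t j| = 1 := by rw [← l1_apply]; exact ht
  exact (Finset.single_le_sum (f := fun j => |t j|) (fun i _ => abs_nonneg _)
    (Finset.mem_univ j)).trans_eq ht'

/-- By homogeneity, an inequality between elements of `ℋ_n` may be checked on the sphere. -/
theorem le_of_le_on_sphere {f g : HomogFun n} (h : ∀ t ∈ sphere n, f.1 t ≤ g.1 t)
    (t : Fin n → ℝ) : f.1 t ≤ g.1 t := by
  rcases (l1_nonneg t).eq_or_lt with h0 | h0
  · have h1 : t = (0 : ℝ) • t := by rw [zero_smul]; exact l1_eq_zero h0.symm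
    rw [h1, f.2 0 le_rfl, g.2 0 le_rfl, zero_mul, zero_mul]
  · set c := (l1 n).1 t with hc
    have h1 : t = c • c⁻¹ • t := by rw [smul_smul, mul_inv_cancel₀ h0.ne', one_smul]
    have h2 : c⁻¹ • t ∈ sphere n := by
      change (l1 n).1 (c⁻¹ • t) = 1
      rw [(l1 n).2 _ (inv_nonneg.2 h0.le), ← hc, inv_mul_cancel₀ h0.ne']
    rw [h1, f.2 c h0.le, g.2 c h0.le]
    exact mul_le_mul_of_nonneg_left (h _ h2) h0.le

theorem l1_mem {W : Submodule ℝ (HomogFun n)} (hsup : ∀ f ∈ W, ∀ g ∈ W, f ⊔ g ∈ W)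
    (hproj : ∀ j, proj n j ∈ W) : l1 n ∈ W :=
  Submodule.sum_mem _ fun j _ => hsup _ (hproj j) _ (Submodule.neg_mem _ (hproj j))

/-- A vector sublattice of `ℋ_n` which contains the coordinate projections is dense: restricted
to the sphere it contains the constants, because `l1` is `1` there, so that the lattice form of
the Stone–Weierstrass theorem applies. -/
theorem exists_approx {W : Submodule ℝ (HomogFun n)} (hsup : ∀ f ∈ W, ∀ g ∈ W, f ⊔ g ∈ W)
    (hproj : ∀ j, proj n j ∈ W) (h : HomogFun n) {ε : ℝ} (hε : 0 < ε) :
    ∃ g ∈ W, (∀ t, h.1 t ≤ (g + ε • l1 n).1 t) ∧ ∀ t, g.1 t ≤ (h + ε • l1 n).1 t := by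
  have hl1 := l1_mem hsup hproj
  have : CompactSpace (sphere n) := isCompact_iff_compactSpace.1 (isCompact_sphere n)
  let ρ : HomogFun n → C(sphere n, ℝ) := fun f => f.1.restrict (sphere n)
  have hcl : closure (ρ '' W) = ⊤ := by
    apply ContinuousMap.sublattice_closure_eq_top
    · exact ⟨_, 0, W.zero_mem, rfl⟩
    · rintro _ ⟨f, hf, rfl⟩ _ ⟨g, hg, rfl⟩
      refine ⟨-(-f ⊔ -g), W.neg_mem (hsup _ (W.neg_mem hf) _ (W.neg_mem hg)), ?_⟩
      ext t
      change -(max (-f.1 t) (-g.1 t)) = min (f.1 t) (g.1 t)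
      rw [max_neg_neg, neg_neg]
    · rintro _ ⟨f, hf, rfl⟩ _ ⟨g, hg, rfl⟩
      exact ⟨f ⊔ g, hsup _ hf _ hg, rfl⟩
    · intro v s t
      by_cases hst : s = t
      · subst hst
        refine ⟨_, ⟨v s • l1 n, W.smul_mem _ hl1, rfl⟩, ?_, ?_⟩ <;>
        · change v s * (l1 n).1 s = v s
          rw [show (l1 n).1 s = 1 from s.2, mul_one]
      · obtain ⟨j, hj⟩ : ∃ j, s.1 j ≠ t.1 j := by
          by_contra! hc
          exact hst (Subtype.ext (funext hc))
        have hj' : s.1 j - t.1 j ≠ 0 := sub_ne_zero.2 hj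
        -- the affine function of `t j` which takes the prescribed values at `s` and `t`
        set b : ℝ := (v s - v t) / (s.1 j - t.1 j) with hb
        have hb' : b * (s.1 j - t.1 j) = v s - v t := div_mul_cancel₀ _ hj'
        refine ⟨_, ⟨(v s - b * s.1 j) • l1 n + b • proj n j,
          W.add_mem (W.smul_mem _ hl1) (W.smul_mem _ (hproj j)), rfl⟩, ?_, ?_⟩
        · change (v s - b * s.1 j) * (l1 n).1 s + b * s.1 j = v s
          rw [show (l1 n).1 s = 1 from s.2]
          ring
        · change (v s - b * s.1 j) * (l1 n).1 t + b * t.1 j = v t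
          rw [show (l1 n).1 t = 1 from t.2]
          linarith
  have hh : ρ h ∈ closure (ρ '' W) := by rw [hcl]; trivial
  obtain ⟨_, ⟨g, hg, rfl⟩, hd⟩ := Metric.mem_closure_iff.1 hh ε hε
  have hd' : ∀ t ∈ sphere n, |h.1 t - g.1 t| < ε := fun t ht => by
    rw [← Real.dist_eq]
    exact (ContinuousMap.dist_apply_le_dist (f := ρ h) (g := ρ g) ⟨t, ht⟩).trans_lt hd
  refine ⟨g, hg, le_of_le_on_sphere fun t ht => ?_, le_of_le_on_sphere fun t ht => ?_⟩
  · change h.1 t ≤ g.1 t + ε * (l1 n).1 t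
    rw [show (l1 n).1 t = 1 from ht]
    linarith [(abs_lt.1 (hd' t ht)).2]
  · change g.1 t ≤ h.1 t + ε * (l1 n).1 t
    rw [show (l1 n).1 t = 1 from ht]
    linarith [(abs_lt.1 (hd' t ht)).1]

end HomogFun

/-! ### The dual norm -/

namespace BanachSequenceLattice

variable (Y : BanachSequenceLattice) {n : ℕ}

theorem normRn_single_pos (j : Fin n) : 0 < Y.normRn n (Pi.single j 1) := by
  refine lt_of_le_of_ne (apply_nonneg _ _) fun h => ?_
  have h0 := Y.eq_zero_of_norm_eq_zero _ h.symm
  have h1 := congrFun (congrArg Subtype.val h0) (j : ℕ)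
  simp [LinearMap.codRestrict_apply, extendByZero] at h1

theorem abs_mul_normRn_single_le (t : Fin n → ℝ) (j : Fin n) :
    |t j| * Y.normRn n (Pi.single j 1) ≤ Y.normRn n t := by
  rw [← Real.norm_eq_abs, ← map_smul_eq_mul]
  obtain ⟨_, h⟩ := Y.solid (extendByZero n (t j • Pi.single j 1))
    ⟨extendByZero n t, Y.extendByZero_mem n t⟩ (fun k => by
      by_cases hk : k < n
      · by_cases hkj : (⟨k, hk⟩ : Fin n) = j
        · subst hkj
          simp [extendByZero, hk]
        · simp [extendByZero, hk, hkj]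
      · simp [extendByZero, hk])
  exact h

theorem bddAbove_dualNorm (a : Fin n → ℝ) :
    BddAbove {r : ℝ | ∃ t : Fin n → ℝ, Y.normRn n t ≤ 1 ∧ r = |∑ j, a j * t j|} := by
  refine ⟨∑ j, |a j| * (Y.normRn n (Pi.single j 1))⁻¹, ?_⟩
  rintro _ ⟨t, ht, rfl⟩
  refine (Finset.abs_sum_le_sum_abs _ _).trans (Finset.sum_le_sum fun j _ => ?_)
  rw [abs_mul]
  refine mul_le_mul_of_nonneg_left ?_ (abs_nonneg _)
  rw [← one_div, le_div_iff₀ (Y.normRn_single_pos j)]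
  exact (Y.abs_mul_normRn_single_le t j).trans ht

theorem sum_mul_le_normRn {a : Fin n → ℝ} (ha : Y.dualNorm n a ≤ 1) (t : Fin n → ℝ) :
    ∑ j, a j * t j ≤ Y.normRn n t := by
  have hle : ∀ s : Fin n → ℝ, Y.normRn n s ≤ 1 → ∑ j, a j * s j ≤ 1 := fun s hs =>
    (le_abs_self _).trans ((le_csSup (Y.bddAbove_dualNorm a) ⟨s, hs, rfl⟩).trans ha)
  -- rescaling by any `c > ‖t‖` avoids a separate discussion of `t = 0`
  refine le_of_forall_gt_imp_ge_of_dense fun c hc => ?_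
  have hc0 : 0 < c := (apply_nonneg _ _).trans_lt hc
  have h1 := hle (c⁻¹ • t) (by
    rw [map_smul_eq_mul, Real.norm_eq_abs, abs_of_pos (inv_pos.2 hc0), inv_mul_le_iff₀ hc0,
      mul_one]
    exact hc.le)
  have h2 : ∑ j, a j * (c⁻¹ • t) j = c⁻¹ * ∑ j, a j * t j := by
    rw [Finset.mul_sum]
    exact Finset.sum_congr rfl fun j _ => by simp only [Pi.smul_apply, smul_eq_mul]; ring
  rwa [h2, inv_mul_le_iff₀ hc0, mul_one] at h1

theorem exists_dualNorm_le_one_sum_eq (t : Fin n → ℝ) :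
    ∃ a : Fin n → ℝ, Y.dualNorm n a ≤ 1 ∧ ∑ j, a j * t j = Y.normRn n t := by
  rcases eq_or_ne t 0 with rfl | ht
  · refine ⟨0, csSup_le ⟨_, 0, by simp, rfl⟩ ?_, by simp⟩
    rintro _ ⟨s, _, rfl⟩
    simp
  obtain ⟨g, hg, hgle⟩ := exists_extension_of_le_sublinear
    (LinearPMap.mkSpanSingleton t (Y.normRn n t) ht) (Y.normRn n)
    (fun c hc s => by rw [map_smul_eq_mul, Real.norm_eq_abs, abs_of_pos hc])
    (map_add_le_add _) (by
      rintro ⟨s, hs⟩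
      obtain ⟨c, rfl⟩ := Submodule.mem_span_singleton.1 hs
      erw [LinearPMap.mkSpanSingleton'_apply]
      simp only [map_smul_eq_mul, Real.norm_eq_abs, smul_eq_mul, RingHom.id_apply]
      exact mul_le_mul_of_nonneg_right (le_abs_self c) (apply_nonneg _ _))
  have hsum : ∀ s : Fin n → ℝ, ∑ j, g (Pi.single j 1) * s j = g s := fun s => by
    conv_rhs => rw [← Finset.univ_sum_single s, map_sum]
    refine Finset.sum_congr rfl fun j _ => ?_
    rw [mul_comm, ← smul_eq_mul, ← map_smul, ← Pi.single_smul, smul_eq_mul, mul_one]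
  refine ⟨fun j => g (Pi.single j 1), csSup_le ⟨_, 0, by simp, rfl⟩ ?_, ?_⟩
  · rintro _ ⟨s, hs, rfl⟩
    rw [hsum, abs_le']
    refine ⟨(hgle s).trans hs, ?_⟩
    rw [← map_neg]
    exact (hgle (-s)).trans (by rwa [map_neg_eq_map])
  · rw [hsum]
    have := hg ⟨t, Submodule.mem_span_singleton_self t⟩
    rw [this]
    exact LinearPMap.mkSpanSingleton_apply ℝ ℝ ht _

end BanachSequenceLattice

/-! ### Existence and uniqueness of the functional calculus -/

/-- The Archimedean property of a normed lattice. -/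
theorem le_of_forall_le_add_smul {X : Type*} [NormedAddCommGroup X] [NormedSpace ℝ X] [Lattice X]
    [IsOrderedAddMonoid X] [HasSolidNorm X] {a b c : X} (h : ∀ ε > (0 : ℝ), a ≤ b + ε • c) :
    a ≤ b := by
  have hlim : Tendsto (fun ε : ℝ => b + ε • c) (𝓝[>] 0) (𝓝 b) := by
    have : Continuous fun ε : ℝ => b + ε • c := by fun_prop
    simpa using (this.tendsto 0).mono_left nhdsWithin_le_nhds
  exact ge_of_tendsto hlim (eventually_mem_nhdsWithin.mono fun ε hε => h ε hε)

/-- The pairs `(π_j, x_j)`, from which the graph of the functional calculus is generated. -/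
def graphGen {X : Type*} {n : ℕ} (x : Fin n → X) (j : Fin n) : ((Fin n → ℝ) → ℝ) × X :=
  (fun t => t j, x j)

theorem linearCombination_graphGen {X : Type*} [AddCommGroup X] [Module ℝ X] {n : ℕ}
    (x : Fin n → X) (a : Fin n → ℝ) :
    Fintype.linearCombination ℝ (graphGen x) a =
      (fun t => ∑ j, a j * t j, Fintype.linearCombination ℝ x a) := by
  simp only [Fintype.linearCombination_apply, graphGen]
  ext <;> simp [Prod.fst_sum, Prod.snd_sum]

theorem absSum_graphGen_fst {X : Type*} [AddCommGroup X] [Lattice X] {n : ℕ} (x : Fin n → X) :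
    (absSum (graphGen x)).1 = HomogFun.toFun n (HomogFun.l1 n) := by
  rw [absSum, Prod.fst_sum, HomogFun.l1, map_sum]
  rfl

/-- A linear map which preserves suprema is monotone. -/
theorem IsKrivineCalculus.mono {X : Type*} [NormedAddCommGroup X] [NormedSpace ℝ X] [Lattice X]
    {n : ℕ} {x : Fin n → X} {τ : HomogFun n →ₗ[ℝ] X}
    (hτ : IsKrivineCalculus x τ) {f g : HomogFun n} (h : ∀ t, f.1 t ≤ g.1 t) :
    τ f ≤ τ g := by
  have h1 : f ⊔ g = g := HomogFun.ext' fun t => sup_eq_right.2 (h t)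
  rw [← h1, hτ.map_sup]
  exact le_sup_left

section Calculus

variable {X : Type*} [NormedAddCommGroup X] [NormedSpace ℝ X] [Lattice X]
  [IsOrderedAddMonoid X] [IsOrderedModule ℝ X] [HasSolidNorm X] {n : ℕ}

/-- If `⋁ a · t ≤ ⋁ b · t` for all `t ∈ ℝⁿ`, with `a` in `S` and `b` in `T`, then each `a` is in
the closed convex hull of `T`, since otherwise some `t` would separate them; hence
`∑ j, a j • x j` is at most the corresponding supremum in `X`. -/
theorem snd_le_snd_of_mem_linearSups {x : Fin n → X} {p q : ((Fin n → ℝ) → ℝ) × X}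
    (hp : p ∈ linearSups (graphGen x)) (hq : q ∈ linearSups (graphGen x)) (h : p.1 ≤ q.1) :
    p.2 ≤ q.2 := by
  obtain ⟨S, hS⟩ := hp
  obtain ⟨T, hT⟩ := hq
  have hbound : ∀ {v : ((Fin n → ℝ) → ℝ) × X} {U : Set (Fin n → ℝ)},
      IsLUB (Fintype.linearCombination ℝ (graphGen x) '' U) v → ∀ a ∈ U,
        (∀ t, ∑ j, a j * t j ≤ v.1 t) ∧ Fintype.linearCombination ℝ x a ≤ v.2 := by
    intro v U hv a ha
    have := hv.1 ⟨a, ha, rfl⟩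
    rw [linearCombination_graphGen] at this
    exact ⟨fun t => this.1 t, this.2⟩
  rw [isLUB_prod] at hS
  refine hS.2.2 ?_
  rintro _ ⟨_, ⟨a, ha, rfl⟩, rfl⟩
  rw [linearCombination_graphGen]
  change Fintype.linearCombination ℝ x a ≤ q.2
  have hcont : Continuous (Fintype.linearCombination ℝ x) :=
    LinearMap.continuous_of_finiteDimensional _
  have hsub : closure (convexHull ℝ T) ⊆ Fintype.linearCombination ℝ x ⁻¹' Set.Iic q.2 :=
    closure_minimal
      (convexHull_min (fun b hb => (hbound hT b hb).2) ((convex_Iic q.2).linear_preimage _))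
      (isClosed_Iic.preimage hcont)
  refine hsub ?_
  by_contra hna
  obtain ⟨φ, u, hφ, hu⟩ := geometric_hahn_banach_closed_point
    (convex_convexHull ℝ T).closure isClosed_closure hna
  have hsum : ∀ s : Fin n → ℝ, ∑ j, s j * φ (Pi.single j 1) = φ s := fun s => by
    conv_rhs => rw [← Finset.univ_sum_single s, map_sum]
    refine Finset.sum_congr rfl fun j _ => ?_
    rw [← smul_eq_mul, ← map_smul, ← Pi.single_smul, smul_eq_mul, mul_one]
  set t : Fin n → ℝ := fun j => φ (Pi.single j 1)
  have h1 : φ a ≤ p.1 t := by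
    have := (hbound (isLUB_prod.2 hS) a ha).1 t
    rwa [hsum] at this
  have h2 : q.1 t ≤ u := by
    refine (isLUB_pi.1 (isLUB_prod.1 hT).1 t).2 ?_
    rintro _ ⟨_, ⟨_, ⟨b, hb, rfl⟩, rfl⟩, rfl⟩
    rw [linearCombination_graphGen]
    change ∑ j, b j * t j ≤ u
    rw [hsum]
    exact (hφ b (subset_closure (subset_convexHull ℝ T hb))).le
  exact absurd (h1.trans ((h t).trans h2)) (not_le.2 hu)

theorem snd_nonneg_of_mem_latticeSpan {x : Fin n → X} {v : ((Fin n → ℝ) → ℝ) × X}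
    (hv : v ∈ latticeSpan (graphGen x)) (h : 0 ≤ v.1) : 0 ≤ v.2 := by
  obtain ⟨p, hp, q, hq, rfl⟩ := hv
  exact sub_nonneg.2 (snd_le_snd_of_mem_linearSups hq hp (sub_nonneg.1 h))

theorem snd_nonneg_of_mem_uniformLatticeSpan {x : Fin n → X} {w : ((Fin n → ℝ) → ℝ) × X}
    (hw : w ∈ uniformLatticeSpan (graphGen x)) (h : 0 ≤ w.1) : 0 ≤ w.2 := by
  refine le_of_forall_le_add_smul (c := (2 : ℝ) • (absSum (graphGen x)).2) fun ε hε => ?_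
  obtain ⟨v, hv, h1, h2⟩ := hw ε hε
  have h3 : 0 ≤ v.2 + ε • (absSum (graphGen x)).2 :=
    snd_nonneg_of_mem_latticeSpan (v := v + ε • absSum (graphGen x))
      (Submodule.add_mem _ hv (Submodule.smul_mem _ _ (absSum_mem_latticeSpan _)))
      (h.trans h1.1)
  refine h3.trans ((add_le_add_left h2.2 _).trans_eq ?_)
  change w.2 + ε • (absSum (graphGen x)).2 + ε • (absSum (graphGen x)).2 = _
  module

theorem eq_of_mem_uniformLatticeSpan {x : Fin n → X} {f : (Fin n → ℝ) → ℝ} {y y' : X}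
    (hy : (f, y) ∈ uniformLatticeSpan (graphGen x))
    (hy' : (f, y') ∈ uniformLatticeSpan (graphGen x)) : y = y' := by
  refine le_antisymm (sub_nonneg.1 ?_) (sub_nonneg.1 ?_)
  · exact snd_nonneg_of_mem_uniformLatticeSpan (Submodule.sub_mem _ hy' hy) (by simp)
  · exact snd_nonneg_of_mem_uniformLatticeSpan (Submodule.sub_mem _ hy hy') (by simp)

/-- Every `h ∈ ℋ_n` is a uniform limit of first components of `latticeSpan (graphGen x)`; by
positivity the second components form a Cauchy sequence, whose limit is the partner of `h`. -/
theorem exists_mem_uniformLatticeSpan [CompleteSpace X] (x : Fin n → X) (h : HomogFun n) :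
    ∃ y : X, (HomogFun.toFun n h, y) ∈ uniformLatticeSpan (graphGen x) := by
  set e := absSum (graphGen x) with he
  let W : Submodule ℝ (HomogFun n) :=
    ((latticeSpan (graphGen x)).map (LinearMap.fst ℝ _ X)).comap (HomogFun.toFun n)
  have hW : ∀ {g}, g ∈ W ↔ ∃ y, (HomogFun.toFun n g, y) ∈ latticeSpan (graphGen x) := by
    intro g
    constructor
    · rintro ⟨⟨_, y⟩, hy, rfl⟩
      exact ⟨y, hy⟩
    · rintro ⟨y, hy⟩
      exact ⟨_, hy, rfl⟩
  have happrox : ∀ k : ℕ, ∃ v ∈ latticeSpan (graphGen x),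
      HomogFun.toFun n h ≤ v.1 + ((1 / 2 : ℝ) ^ k) • e.1 ∧
        v.1 ≤ HomogFun.toFun n h + ((1 / 2 : ℝ) ^ k) • e.1 := by
    intro k
    obtain ⟨g, hg, h1, h2⟩ := HomogFun.exists_approx (W := W)
      (fun f hf g hg => by
        obtain ⟨y, hy⟩ := hW.1 hf
        obtain ⟨z, hz⟩ := hW.1 hg
        exact hW.2 ⟨y ⊔ z, sup_mem_latticeSpan hy hz⟩)
      (fun j => hW.2 ⟨x j, mem_latticeSpan_apply (graphGen x) j⟩) h
      (ε := (1 / 2 : ℝ) ^ k) (by positivity)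
    obtain ⟨y, hy⟩ := hW.1 hg
    refine ⟨_, hy, ?_, ?_⟩ <;> rw [he, absSum_graphGen_fst]
    · exact h1
    · exact h2
  choose v hv h1 h2 using happrox
  have hle : ∀ k m : ℕ, (v k).2 ≤ (v m).2 + ((1 / 2 : ℝ) ^ k + (1 / 2 : ℝ) ^ m) • e.2 := by
    intro k m
    have hmem : v m + ((1 / 2 : ℝ) ^ k + (1 / 2 : ℝ) ^ m) • e - v k ∈
        latticeSpan (graphGen x) :=
      Submodule.sub_mem _ (Submodule.add_mem _ (hv m)
        (Submodule.smul_mem _ _ (absSum_mem_latticeSpan _))) (hv k)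
    refine sub_nonneg.1 (snd_nonneg_of_mem_latticeSpan hmem (sub_nonneg.2 ?_))
    refine (h2 k).trans ((add_le_add_left (h1 m) _).trans_eq ?_)
    change _ = (v m).1 + ((1 / 2 : ℝ) ^ k + (1 / 2 : ℝ) ^ m) • e.1
    module
  have hcauchy : CauchySeq fun k => (v k).2 := by
    refine cauchySeq_of_le_geometric (1 / 2) (2 * ‖e.2‖) (by norm_num) fun k => ?_
    set c : ℝ := (1 / 2 : ℝ) ^ k + (1 / 2 : ℝ) ^ (k + 1) with hc
    have hc0 : 0 ≤ c := by positivity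
    have habs : |(v k).2 - (v (k + 1)).2| ≤ |c • e.2| := by
      refine le_trans ?_ (le_abs_self _)
      rw [abs_le']
      constructor
      · exact sub_le_iff_le_add'.2 (hle k (k + 1))
      · rw [neg_sub, hc, add_comm (_ ^ k)]
        exact sub_le_iff_le_add'.2 (hle (k + 1) k)
    rw [dist_eq_norm]
    refine (norm_le_norm_of_abs_le_abs habs).trans ?_
    rw [norm_smul, Real.norm_of_nonneg hc0]
    have hc2 : c ≤ 2 * (1 / 2 : ℝ) ^ k := by
      have : (0 : ℝ) ≤ (1 / 2 : ℝ) ^ k := by positivity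
      rw [hc, pow_succ]
      linarith
    exact (mul_le_mul_of_nonneg_right hc2 (norm_nonneg _)).trans_eq (by ring)
  obtain ⟨y, hy⟩ := cauchySeq_tendsto_of_complete hcauchy
  have hpow : Tendsto (fun m : ℕ => (1 / 2 : ℝ) ^ m) atTop (𝓝 0) :=
    tendsto_pow_atTop_nhds_zero_of_lt_one (by norm_num) (by norm_num)
  have hlim : ∀ (k : ℕ) (z : X),
      Tendsto (fun m : ℕ => z + ((1 / 2 : ℝ) ^ k + (1 / 2 : ℝ) ^ m) • e.2) atTop
        (𝓝 (z + (1 / 2 : ℝ) ^ k • e.2)) := fun k z => by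
    simpa using tendsto_const_nhds.add ((tendsto_const_nhds.add hpow).smul_const e.2)
  have hy1 : ∀ k, y ≤ (v k).2 + (1 / 2 : ℝ) ^ k • e.2 := fun k =>
    le_of_tendsto_of_tendsto' hy (hlim k _) fun m => by
      rw [add_comm (_ ^ k)]
      exact hle m k
  have hy2 : ∀ k, (v k).2 ≤ y + (1 / 2 : ℝ) ^ k • e.2 := fun k => by
    have h3 : Tendsto (fun m : ℕ => (v m).2 + ((1 / 2 : ℝ) ^ k + (1 / 2 : ℝ) ^ m) • e.2) atTop
        (𝓝 (y + (1 / 2 : ℝ) ^ k • e.2)) := by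
      simpa using hy.add ((tendsto_const_nhds.add hpow).smul_const e.2)
    exact ge_of_tendsto' h3 fun m => hle k m
  have he0 : 0 ≤ e := Finset.sum_nonneg fun j _ => abs_nonneg (graphGen x j)
  refine ⟨y, fun ε hε => ?_⟩
  obtain ⟨k, hk⟩ := exists_pow_lt_of_lt_one hε (by norm_num : (1 / 2 : ℝ) < 1)
  have hs1 : (1 / 2 : ℝ) ^ k • e.1 ≤ ε • e.1 := fun t =>
    mul_le_mul_of_nonneg_right hk.le (he0.1 t)
  have hs2 : (1 / 2 : ℝ) ^ k • e.2 ≤ ε • e.2 := smul_le_smul_of_nonneg_right hk.le he0.2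
  exact ⟨v k, hv k,
    ⟨(h1 k).trans (add_le_add_right hs1 _), (hy1 k).trans (add_le_add_right hs2 _)⟩,
    (h2 k).trans (add_le_add_right hs1 _), (hy2 k).trans (add_le_add_right hs2 _)⟩

theorem exists_isKrivineCalculus [CompleteSpace X] (x : Fin n → X) :
    ∃ τ : HomogFun n →ₗ[ℝ] X, IsKrivineCalculus x τ := by
  choose τ hτ using exists_mem_uniformLatticeSpan x
  refine ⟨⟨⟨τ, fun f g => ?_⟩, fun c f => ?_⟩, fun j => ?_, fun f g => ?_⟩
  · exact eq_of_mem_uniformLatticeSpan (hτ (f + g)) (Submodule.add_mem _ (hτ f) (hτ g))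
  · exact eq_of_mem_uniformLatticeSpan (hτ (c • f)) (Submodule.smul_mem _ c (hτ f))
  · exact eq_of_mem_uniformLatticeSpan (hτ _)
      (latticeSpan_le_uniformLatticeSpan _ (mem_latticeSpan_apply (graphGen x) j))
  · exact eq_of_mem_uniformLatticeSpan (hτ (f ⊔ g)) (sup_mem_uniformLatticeSpan (hτ f) (hτ g))

end Calculus

namespace IsKrivineCalculus

variable {X : Type*} [NormedAddCommGroup X] [NormedSpace ℝ X] [Lattice X]
  [IsOrderedAddMonoid X] [HasSolidNorm X] {n : ℕ} {x : Fin n → X} {τ τ' : HomogFun n →ₗ[ℝ] X}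

theorem apply_le (hτ : IsKrivineCalculus x τ) (hτ' : IsKrivineCalculus x τ')
    (h : HomogFun n) : τ h ≤ τ' h := by
  have hmem : ∀ {f}, f ∈ LinearMap.eqLocus τ τ' ↔ τ f = τ' f := Iff.rfl
  have hsup : ∀ f ∈ LinearMap.eqLocus τ τ', ∀ g ∈ LinearMap.eqLocus τ τ',
      f ⊔ g ∈ LinearMap.eqLocus τ τ' := by
    intro f hf g hg
    rw [hmem] at hf hg ⊢
    rw [hτ.map_sup, hτ'.map_sup, hf, hg]
  have hproj : ∀ j, HomogFun.proj n j ∈ LinearMap.eqLocus τ τ' := fun j => by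
    rw [hmem, hτ.map_proj, hτ'.map_proj]
  have hl1 : τ (HomogFun.l1 n) = τ' (HomogFun.l1 n) := HomogFun.l1_mem hsup hproj
  refine le_of_forall_le_add_smul (c := (2 : ℝ) • τ' (HomogFun.l1 n)) fun ε hε => ?_
  obtain ⟨g, hg, h1, h2⟩ := HomogFun.exists_approx hsup hproj h hε
  have e1 := hτ.mono h1
  have e2 := hτ'.mono h2
  rw [map_add, map_smul] at e1 e2
  rw [hmem.1 hg, hl1] at e1
  exact e1.trans ((add_le_add_left e2 _).trans_eq (by module))

/-- Two lattice homomorphisms which agree on the projections agree on a dense vector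
sublattice of `ℋ_n`, and by positivity everywhere. -/
theorem unique (hτ : IsKrivineCalculus x τ) (hτ' : IsKrivineCalculus x τ') : τ = τ' :=
  LinearMap.ext fun h => le_antisymm (hτ.apply_le hτ' h) (hτ'.apply_le hτ h)

end IsKrivineCalculus

/-! ### The supremum formula -/

/-- The supremum formula holds for the image of `‖·‖_{ℝⁿ,Y}` under any map with the properties of
the functional calculus. For the lower estimate, the norm is a supremum of functionals of dual
norm at most `1`, so by compactness of the sphere it is uniformly approximated by elements
`h ∈ ℋ_n` with `τ h ≤ u`, whenever `u` is an upper bound. -/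
theorem IsKrivineCalculus.isLUB {X : Type*} [NormedAddCommGroup X] [NormedSpace ℝ X] [Lattice X]
    [IsOrderedAddMonoid X] [HasSolidNorm X] {n : ℕ} {x : Fin n → X}
    {τ : HomogFun n →ₗ[ℝ] X} (hτ : IsKrivineCalculus x τ) (Y : BanachSequenceLattice) :
    IsLUB {y : X | ∃ a : Fin n → ℝ, Y.dualNorm n a ≤ 1 ∧ y = ∑ j, a j • x j}
      (τ (Y.normHomog n)) := by
  have hlin : ∀ a : Fin n → ℝ, τ (∑ j, a j • HomogFun.proj n j) = ∑ j, a j • x j := fun a => by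
    rw [map_sum]
    exact Finset.sum_congr rfl fun j _ => by rw [map_smul, hτ.map_proj]
  have heval : ∀ (a t : Fin n → ℝ),
      (∑ j, a j • HomogFun.proj n j : HomogFun n).1 t = ∑ j, a j * t j := fun a t => by
    change HomogFun.toFun n _ t = _
    rw [map_sum, Finset.sum_apply]
    rfl
  constructor
  · rintro _ ⟨a, ha, rfl⟩
    rw [← hlin]
    refine hτ.mono fun t => ?_
    rw [heval]
    exact Y.sum_mul_le_normRn ha t
  · intro u hu
    refine le_of_forall_le_add_smul (c := τ (HomogFun.l1 n)) fun ε hε => ?_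
    obtain ⟨h, hhu, hh⟩ : ∃ h : HomogFun n, τ h ≤ u ∧
        ∀ t ∈ HomogFun.sphere n, Y.normRn n t < h.1 t + ε := by
      have hnear : ∀ s : Fin n → ℝ, ∃ a : Fin n → ℝ,
          τ (∑ j, a j • HomogFun.proj n j) ≤ u ∧
          Y.normRn n s < (∑ j, a j • HomogFun.proj n j : HomogFun n).1 s + ε := fun s => by
        obtain ⟨a, ha, has⟩ := Y.exists_dualNorm_le_one_sum_eq s
        refine ⟨a, (hlin a).trans_le (hu ⟨a, ha, rfl⟩), ?_⟩
        rw [heval, has]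
        exact lt_add_of_pos_right _ hε
      refine (HomogFun.isCompact_sphere n).induction_on
        (p := fun s => ∃ h : HomogFun n, τ h ≤ u ∧ ∀ t ∈ s, Y.normRn n t < h.1 t + ε) ?_ ?_ ?_ ?_
      · obtain ⟨a, ha, -⟩ := hnear 0
        exact ⟨_, ha, fun t ht => ht.elim⟩
      · rintro s s' hss ⟨h, hhu, hh⟩
        exact ⟨h, hhu, fun t ht => hh t (hss ht)⟩
      · rintro s s' ⟨h, hhu, hh⟩ ⟨h', hhu', hh'⟩
        refine ⟨h ⊔ h', (hτ.map_sup h h').trans_le (sup_le hhu hhu'), ?_⟩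
        rintro t (ht | ht)
        · exact (hh t ht).trans_le (add_le_add_left le_sup_left _)
        · exact (hh' t ht).trans_le (add_le_add_left le_sup_right _)
      · intro s _
        obtain ⟨a, ha, has⟩ := hnear s
        refine ⟨_, mem_nhdsWithin_of_mem_nhds (IsOpen.mem_nhds (isOpen_lt
          (Y.continuous_normRn n)
          ((∑ j, a j • HomogFun.proj n j : HomogFun n).1.continuous.add continuous_const)) has),
          _, ha, fun t ht => ht⟩
    have hle : ∀ t, (Y.normHomog n).1 t ≤ (h + ε • HomogFun.l1 n).1 t := by
      refine HomogFun.le_of_le_on_sphere fun t ht => ?_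
      change Y.normRn n t ≤ h.1 t + ε * (HomogFun.l1 n).1 t
      rw [show (HomogFun.l1 n).1 t = 1 from ht, mul_one]
      exact (hh t ht).le
    have h1 := hτ.mono hle
    rw [map_add, map_smul] at h1
    exact h1.trans (add_le_add_left hhu _)

theorem mainTheorem2 {X : Type*} [NormedAddCommGroup X] [NormedSpace ℝ X] [Lattice X]
    [IsOrderedAddMonoid X] [IsOrderedModule ℝ X] [HasSolidNorm X] [CompleteSpace X]
    (Y : BanachSequenceLattice) (n : ℕ) (x : Fin n → X) :
    (∃! τ : HomogFun n →ₗ[ℝ] X, IsKrivineCalculus x τ) ∧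
      IsLUB {y : X | ∃ a : Fin n → ℝ, Y.dualNorm n a ≤ 1 ∧ y = ∑ j, a j • x j}
        (krivineNorm Y x) := by
  have hex := exists_isKrivineCalculus x
  have hspec : IsKrivineCalculus x (krivineCalculus x) := by
    rw [krivineCalculus, dif_pos hex]
    exact hex.choose_spec
  exact ⟨⟨_, hspec, fun _ hτ => hτ.unique hspec⟩, hspec.isLUB Y⟩
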